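/- Let $X$ be a compact, Hausdorff, path-connected smooth manifold without boundary, of finite dimension, and let $\tau:X\to X$ be a smooth involution. Let $\pi:P\to X$ be a smooth principal $U(n)$-bundle with right action $(p,u)\mapsto p\cdot u$, and let $\hat\Theta:P\to P$ be a smooth involution with $\pi\circ\hat\Theta=\tau\circ\pi$. Let $\omega\in\Omega^1(P,\mathfrak u(n))$ be a connection 1-form. Assume one of the following. * ("Real" case) $n=m$, $\hat\Theta(p\cdot u)=\hat\Theta(p)\cdot\overline u$ for all $p\in P$ and $u\in U(m)$, and $\hat\Theta^*\overline\omega=\omega$. * ("Quaternionic" case) $n=2m$, $\hat\Theta(p\cdot u)=\hat\Theta(p)\cdot\sigma(u)$ for all $p\in P$ and $u\in U(2m)$, and $\hat\Theta^*\sigma(\omega)=\omega$. Here $\sigma(a):=-Q\,\overline a\,Q$ and $Q$ is the block diagonal $2m\times 2m$ matrix with $m$ diagonal blocks $\begin{pmatrix}0&-1\\1&0\end{pmatrix}$. Let $\gamma:[0,1]\to X$ be a piecewise $C^1$ curve, put $\tau(\gamma):=\tau\circ\gamma$ and $P_x:=\pi^{-1}(x)$. For every $p\in P_{\gamma(0)}$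 there is a unique horizontal lift of $\gamma$ starting at $p$, that is, a unique piecewise $C^1$ curve in $P$ that starts at $p$, projects to $\gamma$ and whose tangent vectors are annihilated by $\omega$. Let $\mathrm{PT}_\gamma:P_{\gamma(0)}\to P_{\gamma(1)}$ send $p$ to the endpoint of this lift. Then $$\mathrm{PT}_{\tau(\gamma)}\circ\hat\Theta=\hat\Theta\circ\mathrm{PT}_\gamma \qquad\text{on } P_{\gamma(0)}.$$ If moreover $\gamma$ is a loop, $\gamma(0)=x_0=\gamma(1)$, let $\mathrm{hol}_\gamma(p)\in U(n)$, for $p\in P_{x_0}$, be the element with $\mathrm{PT}_\gamma(p)=p\cdot\mathrm{hol}_\gamma(p)$. Then for every $p\in P_{x_0}$ $$\mathrm{hol}_{\tau(\gamma)}(\hat\Theta(p))=\overline{\mathrm{hol}_\gamma(p)}\quad\text{("Real" case)},\qquad \mathrm{hol}_{\tau(\gamma)}(\hat\Theta(p))=-Q\,\overline{\mathrm{hol}_\gamma(p)}\,Q\quad\text{("Quaternionic" case)}.$$ -/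

import Mathlib

open Set
open scoped Manifold ContDiff Matrix.Norms.L2Operator

noncomputable section

namespace UnitaryLie

private theorem ring_aux1 {R : Type*} [Ring R] {x d : R} (h : (1 - x) * d = 1) :
    (1 + x) * d + 1 = 2 * d := by
  have h' : d - x * d = 1 := by simpa [sub_mul] using h
  rw [add_mul, two_mul, one_mul, ← h']; abel

private theorem ring_aux2 {R : Type*} [Ring R] {x d : R} (h : (1 - x) * d = 1) :
    x * ((1 + x) * d + 1) = (1 + x) * d - 1 := by
  have h' : d - x * d = 1 := by simpa [sub_mul] using h
  rw [ring_aux1 h, add_mul, two_mul, mul_add, one_mul, ← h']; abel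

private theorem ring_aux3 {R : Type*} [Ring R] {w d : R} (h : (w + 1) * d = 1) :
    1 - (w - 1) * d = 2 * d := by
  have h' : w * d + d = 1 := by simpa [add_mul] using h
  rw [sub_mul, two_mul, one_mul, ← h']; abel

private theorem ring_aux4 {R : Type*} [Ring R] {w d : R} (h : (w + 1) * d = 1) :
    w * (2 * d) = 1 + (w - 1) * d := by
  have h' : w * d + d = 1 := by simpa [add_mul] using h
  rw [sub_mul, two_mul, mul_add, one_mul, ← h']; abel

private theorem ring_aux5 {R : Type*} [Ring R] {w v : R} (h : v * w = 1) :
    (v - 1) * (w + 1) = (v + 1) * -(w - 1) := by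
  simp only [sub_mul, add_mul, mul_add, mul_neg, mul_sub, h, mul_one, one_mul]; abel

variable {A : Type*} [CStarAlgebra A]

/-- The Lie algebra of the unitary group of `A`: the real vector space of anti-Hermitian elements. -/
abbrev skew (A : Type*) [CStarAlgebra A] : Submodule ℝ A := skewAdjoint.submodule ℝ A

theorem star_skew (x : skew A) : star (x : A) = -x := skewAdjoint.mem_iff.1 x.2

/-- The Cayley transform. -/
def cayley (w : A) : A := (w - 1) * Ring.inverse (w + 1)

/-- The inverse Cayley transform. -/
def cayleyInv (x : A) : A := (1 + x) * Ring.inverse (1 - x)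

theorem isUnit_one_sub (x : skew A) : IsUnit (1 - (x : A)) := by
  have hs : IsSelfAdjoint (Complex.I • (x : A)) := by
    rw [isSelfAdjoint_iff, star_smul, star_skew]; simp
  by_contra h
  have h1 : (1 : ℂ) ∈ spectrum ℂ (x : A) := by
    rw [spectrum.mem_iff]; simpa using h
  have h2 : Complex.I • (1 : ℂ) ∈ spectrum ℂ (Complex.I • (x : A)) := by
    have := spectrum.unit_smul_eq_smul (x : A) (Units.mk0 Complex.I Complex.I_ne_zero)
    rw [show Complex.I • (x : A) = Units.mk0 Complex.I Complex.I_ne_zero • (x : A) from rfl, this]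
    exact Set.smul_mem_smul_set h1
  have := hs.mem_spectrum_eq_re h2
  simpa using congrArg Complex.im this

theorem isUnit_one_add (x : skew A) : IsUnit (1 + (x : A)) := by
  simpa using isUnit_one_sub (-x)

theorem isUnit_two : IsUnit (2 : A) := by
  have : IsUnit (algebraMap ℂ A 2) := (isUnit_iff_ne_zero.2 two_ne_zero).map _
  rwa [map_ofNat] at this

theorem cayley_mem (w : unitary A) : cayley (w : A) ∈ skew A := by
  change _ ∈ skewAdjoint A
  rw [skewAdjoint.mem_iff]
  by_cases hw : IsUnit ((w : A) + 1)
  · have hw' : IsUnit (star (w : A) + 1) := by simpa using hw.star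
    have e : star (cayley (w : A)) = Ring.inverse (star (w : A) + 1) * (star (w : A) - 1) := by
      rw [cayley, star_mul, ← Ring.inverse_star]; simp
    rw [e, Ring.inverse_mul_eq_iff_eq_mul _ _ _ hw', cayley, ← neg_mul, ← mul_assoc,
      Ring.eq_mul_inverse_iff_mul_eq _ _ _ hw]
    exact ring_aux5 (Unitary.coe_star_mul_self w)
  · simp [cayley, Ring.inverse_non_unit _ hw]

theorem cayleyInv_mem (x : skew A) : cayleyInv (x : A) ∈ unitary A := by
  have hm := isUnit_one_sub x
  have hp := isUnit_one_add x
  have e : star (cayleyInv (x : A)) = Ring.inverse (1 + (x : A)) * (1 - (x : A)) := by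
    rw [cayleyInv, star_mul, ← Ring.inverse_star]; simp [star_skew, sub_eq_add_neg]
  have hc : (1 - (x : A)) * (1 + x) = (1 + x) * (1 - x) := by noncomm_ring
  rw [Unitary.mem_iff, e]
  constructor
  · rw [cayleyInv, mul_assoc, Ring.inverse_mul_eq_iff_eq_mul _ _ _ hp, ← mul_assoc, hc,
      Ring.mul_inverse_cancel_right _ _ hm, mul_one]
  · rw [cayleyInv, mul_assoc, ← mul_assoc (Ring.inverse _)]
    have : Ring.inverse (1 - (x : A)) * Ring.inverse (1 + (x : A)) =
        Ring.inverse (1 + (x : A)) * Ring.inverse (1 - (x : A)) := by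
      rw [← Ring.inverse_mul (Or.inl hp), ← Ring.inverse_mul (Or.inl hm), hc]
    rw [this, mul_assoc, Ring.inverse_mul_cancel _ hm, mul_one, Ring.mul_inverse_cancel _ hp]

theorem inverse_two_mul {a : A} (ha : IsUnit a) :
    Ring.inverse (2 * Ring.inverse a) = a * Ring.inverse 2 := by
  rw [Ring.inverse_mul (Or.inl isUnit_two), Ring.inverse_inverse ha]

theorem isUnit_cayleyInv_add_one (x : skew A) : IsUnit (cayleyInv (x : A) + 1) := by
  have hm := isUnit_one_sub x
  have : cayleyInv (x : A) + 1 = 2 * Ring.inverse (1 - (x : A)) := by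
    exact ring_aux1 (Ring.mul_inverse_cancel _ hm)
  rw [this]
  exact isUnit_two.mul hm.ringInverse

theorem cayley_cayleyInv (x : skew A) : cayley (cayleyInv (x : A)) = x := by
  have hm := isUnit_one_sub x
  rw [cayley, eq_comm, Ring.eq_mul_inverse_iff_mul_eq _ _ _ (isUnit_cayleyInv_add_one x)]
  exact ring_aux2 (Ring.mul_inverse_cancel _ hm)

theorem cayleyInv_cayley {w : A} (hw : IsUnit (w + 1)) : cayleyInv (cayley w) = w := by
  have h := Ring.mul_inverse_cancel _ hw
  have h1 : 1 - cayley w = 2 * Ring.inverse (w + 1) := ring_aux3 h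
  rw [cayleyInv, eq_comm, h1, Ring.eq_mul_inverse_iff_mul_eq _ _ _ (isUnit_two.mul hw.ringInverse),
    cayley]
  exact ring_aux4 h

theorem contDiffAt_cayley {n : ℕ∞ω} {w : A} (hw : IsUnit (w + 1)) :
    ContDiffAt ℝ n (cayley : A → A) w := by
  have h : ContDiffAt ℝ n Ring.inverse (w + 1) := by
    simpa using contDiffAt_ringInverse ℝ hw.unit
  have h2 : ContDiffAt ℝ n (fun w : A => Ring.inverse (w + 1)) w :=
    h.comp w (contDiffAt_id.add contDiffAt_const)
  exact (contDiffAt_id.sub contDiffAt_const).mul h2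

theorem contDiff_cayleyInv {n : ℕ∞ω} : ContDiff ℝ n (fun x : skew A => cayleyInv (x : A)) := by
  rw [contDiff_iff_contDiffAt]
  intro x
  have hc : ContDiff ℝ n (fun x : skew A => (x : A)) := (skew A).subtypeL.contDiff
  have h : ContDiffAt ℝ n Ring.inverse (1 - (x : A)) := by
    simpa using contDiffAt_ringInverse ℝ (isUnit_one_sub x).unit
  have h2 : ContDiffAt ℝ n (fun x : skew A => Ring.inverse (1 - (x : A))) x :=
    h.comp (f := fun x : skew A => 1 - (x : A)) x (contDiffAt_const.sub hc.contDiffAt)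
  exact (contDiffAt_const.add hc.contDiffAt).mul h2

/-- The Cayley chart of the unitary group centred at `u`: it sends `v` to the Cayley transform of
`u⁻¹ v`, and is defined on the open set of those `v` such that `-1` is not in the spectrum of
`u⁻¹ v`. -/
def cayleyChart (u : unitary A) : OpenPartialHomeomorph (unitary A) (skew A) where
  toFun v := ⟨cayley ((u⁻¹ * v : unitary A) : A), cayley_mem _⟩
  invFun x := u * ⟨cayleyInv (x : A), cayleyInv_mem x⟩
  source := {v | IsUnit (((u⁻¹ * v : unitary A) : A) + 1)}
  target := univ
  map_source' _ _ := mem_univ _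
  map_target' x _ := by
    change IsUnit _
    rw [inv_mul_cancel_left]
    exact isUnit_cayleyInv_add_one x
  left_inv' v hv := by
    apply mul_left_cancel (a := u⁻¹)
    rw [inv_mul_cancel_left]
    exact Subtype.ext (cayleyInv_cayley hv)
  right_inv' x _ := by
    apply Subtype.ext
    simpa only [inv_mul_cancel_left] using cayley_cayleyInv x
  open_source := Units.isOpen.preimage (by fun_prop)
  open_target := isOpen_univ
  continuousOn_toFun := by
    intro v hv
    refine ContinuousAt.continuousWithinAt (Topology.IsInducing.subtypeVal.continuousAt_iff.2 ?_)
    exact ContinuousAt.comp (f := fun v : unitary A => ((u⁻¹ * v : unitary A) : A))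
      (contDiffAt_cayley (n := 0) hv).continuousAt (by fun_prop)
  continuousOn_invFun :=
    (continuous_const.mul
      ((contDiff_cayleyInv (n := 0)).continuous.subtype_mk cayleyInv_mem)).continuousOn

instance : ChartedSpace (skew A) (unitary A) where
  atlas := range cayleyChart
  chartAt := cayleyChart
  mem_chart_source u := by
    change IsUnit _
    rw [inv_mul_cancel, OneMemClass.coe_one, one_add_one_eq_two]
    exact isUnit_two
  chart_mem_atlas u := mem_range_self u

/-- The projection of `A` onto its anti-Hermitian part. -/
def skewPart : A →L[ℝ] skew A where
  toFun a := ⟨(2 : ℝ)⁻¹ • (a - star a), skewAdjoint.smul_mem _ (by simp [skewAdjoint.mem_iff])⟩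
  map_add' a b := Subtype.ext <| by simp [← smul_add]; abel
  map_smul' c a := Subtype.ext <| by simp [smul_sub, smul_comm c]
  cont := by fun_prop

theorem skewPart_coe (x : skew A) : skewPart (x : A) = x :=
  Subtype.ext <| by
    change (2 : ℝ)⁻¹ • ((x : A) - star (x : A)) = x
    rw [star_skew, sub_neg_eq_add, ← two_smul ℝ (x : A), smul_smul]; simp

instance (n : ℕ∞ω) : IsManifold 𝓘(ℝ, skew A) n (unitary A) := by
  apply isManifold_of_contDiffOn
  rintro _ _ ⟨u, rfl⟩ ⟨v, rfl⟩
  intro x hx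
  have hx' : IsUnit (((v⁻¹ * (u * ⟨cayleyInv (x : A), cayleyInv_mem x⟩) : unitary A) : A) + 1) := by
    simpa [cayleyChart] using hx
  have h1 : ContDiffAt ℝ n (fun x : skew A =>
      ((v⁻¹ * (u * ⟨cayleyInv (x : A), cayleyInv_mem x⟩) : unitary A) : A)) x := by
    simp only [Submonoid.coe_mul]
    exact contDiffAt_const.mul (contDiffAt_const.mul contDiff_cayleyInv.contDiffAt)
  have h2 := skewPart.contDiff.contDiffAt.comp x ((contDiffAt_cayley hx').comp x h1)
  refine (h2.congr_of_eventuallyEq (Filter.Eventually.of_forall fun y => ?_)).contDiffWithinAt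
  exact (skewPart_coe _).symm

variable {E : Type*} [NormedAddCommGroup E] [NormedSpace ℝ E] {H : Type*} [TopologicalSpace H]
  {I : ModelWithCorners ℝ E H} {M : Type*} [TopologicalSpace M] [ChartedSpace H M] {n : ℕ∞ω}

/-- The inclusion of the unitary group in the ambient algebra is smooth. -/
theorem contMDiff_coe : ContMDiff 𝓘(ℝ, skew A) 𝓘(ℝ, A) n ((↑) : unitary A → A) := by
  intro u
  have h1 := contMDiffAt_extChartAt (I := 𝓘(ℝ, skew A)) (n := n) (x := u)
  have h2 : ContDiff ℝ n (fun x : skew A => (u : A) * cayleyInv (x : A)) :=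
    contDiff_const.mul contDiff_cayleyInv
  refine (h2.contMDiff.contMDiffAt.comp u h1).congr_of_eventuallyEq ?_
  filter_upwards [extChartAt_source_mem_nhds (I := 𝓘(ℝ, skew A)) u] with v hv
  have := congrArg ((↑) : unitary A → A) ((extChartAt 𝓘(ℝ, skew A) u).left_inv hv)
  exact this.symm

/-- A map into the unitary group is smooth exactly when it is smooth as a map into the ambient
algebra. -/
theorem contMDiffWithinAt_iff_coe {f : M → unitary A} {s : Set M} {x : M} :
    ContMDiffWithinAt I 𝓘(ℝ, skew A) n f s x ↔
      ContMDiffWithinAt I 𝓘(ℝ, A) n (fun y => (f y : A)) s x := by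
  refine ⟨fun h => contMDiff_coe.contMDiffAt.comp_contMDiffWithinAt x h, fun h => ?_⟩
  rw [contMDiffWithinAt_iff_target]
  refine ⟨Topology.IsInducing.subtypeVal.continuousWithinAt_iff.2 h.continuousWithinAt, ?_⟩
  have h1 : ContMDiffWithinAt I 𝓘(ℝ, A) n (fun y => (((f x)⁻¹ * f y : unitary A) : A)) s x := by
    have hm : ContDiff ℝ n (fun a : A => (((f x)⁻¹ : unitary A) : A) * a) :=
      contDiff_const.mul contDiff_id
    exact hm.contMDiff.contMDiffAt.comp_contMDiffWithinAt x h
  have hx : IsUnit (((((f x)⁻¹ * f x : unitary A)) : A) + 1) := mem_chart_source (skew A) (f x)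
  have h2 := (skewPart.contDiff.contDiffAt.comp _ (contDiffAt_cayley (n := n) hx)).contMDiffAt
  refine (h2.comp_contMDiffWithinAt x h1).congr (fun y _ => ?_) ?_
  · exact (skewPart_coe _).symm
  · exact (skewPart_coe _).symm

theorem contMDiff_iff_coe {f : M → unitary A} :
    ContMDiff I 𝓘(ℝ, skew A) n f ↔ ContMDiff I 𝓘(ℝ, A) n (fun y => (f y : A)) :=
  forall_congr' fun _ => contMDiffWithinAt_iff_coe

instance : LieGroup 𝓘(ℝ, skew A) n (unitary A) where
  contMDiff_mul := by
    rw [contMDiff_iff_coe]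
    have hm : ContDiff ℝ n (fun a : A × A => a.1 * a.2) := contDiff_fst.mul contDiff_snd
    exact hm.contMDiff.comp
      ((contMDiff_coe.comp contMDiff_fst).prodMk_space (contMDiff_coe.comp contMDiff_snd))
  contMDiff_inv := by
    rw [contMDiff_iff_coe]
    exact (starL' ℝ : A ≃L[ℝ] A).contDiff.contMDiff.comp contMDiff_coe

end UnitaryLie

namespace TimeReversal

/-- The unitary group `U(n)`. -/
abbrev U (n : ℕ) := Matrix.unitaryGroup (Fin n) ℂ

/-- The Lie algebra `u(n)` of anti-Hermitian matrices. -/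
abbrev u (n : ℕ) := UnitaryLie.skew (Matrix (Fin n) (Fin n) ℂ)

/-- The exponential map `u(n) → U(n)`. -/
def expU {n : ℕ} (ξ : u n) : U n :=
  ⟨NormedSpace.exp (ξ : Matrix (Fin n) (Fin n) ℂ),
    letI : NormedAlgebra ℚ (Matrix (Fin n) (Fin n) ℂ) := NormedAlgebra.restrictScalars ℚ ℂ _
    NormedSpace.exp_mem_unitary_of_mem_skewAdjoint ξ.2⟩

/-- Entrywise complex conjugation of matrices. -/
def conjM {n : ℕ} (a : Matrix (Fin n) (Fin n) ℂ) : Matrix (Fin n) (Fin n) ℂ :=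
  a.map (starRingEnd ℂ)

theorem conjM_mul {n : ℕ} (a b : Matrix (Fin n) (Fin n) ℂ) :
    conjM (a * b) = conjM a * conjM b := Matrix.map_mul

theorem conjM_one {n : ℕ} : conjM (1 : Matrix (Fin n) (Fin n) ℂ) = 1 :=
  Matrix.map_one _ (map_zero _) (map_one _)

theorem star_conjM {n : ℕ} (a : Matrix (Fin n) (Fin n) ℂ) : star (conjM a) = conjM (star a) := by
  ext i j; simp [conjM, Matrix.star_apply]

/-- The complex conjugate of a unitary matrix. -/
def conjU {n : ℕ} (g : U n) : U n :=
  ⟨conjM (g : Matrix (Fin n) (Fin n) ℂ), by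
    rw [Matrix.mem_unitaryGroup_iff, star_conjM, ← conjM_mul,
      Matrix.mem_unitaryGroup_iff.1 g.2, conjM_one]⟩

/-- The block diagonal matrix `Q` of size `2m` whose `m` diagonal blocks are `!![0, -1; 1, 0]`. -/
def Q (m : ℕ) : Matrix (Fin (2 * m)) (Fin (2 * m)) ℂ :=
  Matrix.of fun i j =>
    if (i : ℕ) % 2 = 0 ∧ (j : ℕ) = i + 1 then -1
    else if (j : ℕ) % 2 = 0 ∧ (i : ℕ) = j + 1 then 1
    else 0

theorem star_Q (m : ℕ) : star (Q m) = -Q m := by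
  ext i j
  simp only [Matrix.star_apply, Q, Matrix.of_apply, Matrix.neg_apply]
  split_ifs <;> first | omega | simp

theorem Q_mul_Q (m : ℕ) : Q m * Q m = -1 := by
  ext i j
  rw [Matrix.mul_apply]
  rcases Nat.mod_two_eq_zero_or_one (i : ℕ) with hi | hi
  · rw [Finset.sum_eq_single (⟨i + 1, by omega⟩ : Fin (2 * m))]
    · simp only [Q, Matrix.of_apply, Matrix.neg_apply, Matrix.one_apply, Fin.ext_iff]
      split_ifs <;> first | omega | (simp; done) | simp_all
    · intro k _ hk
      have hk' : (k : ℕ) ≠ i + 1 := fun h => hk (Fin.ext h)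
      simp only [Q, Matrix.of_apply]
      rw [if_neg (by omega), if_neg (by omega), zero_mul]
    · simp
  · rw [Finset.sum_eq_single (⟨i - 1, by omega⟩ : Fin (2 * m))]
    · simp only [Q, Matrix.of_apply, Matrix.neg_apply, Matrix.one_apply, Fin.ext_iff]
      split_ifs <;> first | omega | simp
    · intro k _ hk
      have hk' : (k : ℕ) ≠ i - 1 := fun h => hk (Fin.ext h)
      simp only [Q, Matrix.of_apply]
      rw [if_neg (by omega), if_neg (by omega), zero_mul]
    · simp

/-- The involution `a ↦ -Q ā Q` on matrices of size `2m`. -/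
def sigmaM {m : ℕ} (a : Matrix (Fin (2 * m)) (Fin (2 * m)) ℂ) :
    Matrix (Fin (2 * m)) (Fin (2 * m)) ℂ :=
  -(Q m * conjM a * Q m)

/-- The involution `g ↦ -Q ḡ Q` on the unitary group `U(2m)`. -/
def sigmaU {m : ℕ} (g : U (2 * m)) : U (2 * m) :=
  ⟨sigmaM (g : Matrix (Fin (2 * m)) (Fin (2 * m)) ℂ), by
    have h : conjM (g : Matrix (Fin (2 * m)) (Fin (2 * m)) ℂ) * star (conjM g.1) = 1 :=
      Unitary.coe_mul_star_self (conjU g)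
    rw [Matrix.mem_unitaryGroup_iff, sigmaM, star_neg, star_mul, star_mul, star_Q]
    simp only [neg_mul, mul_neg, neg_neg]
    calc Q m * conjM g.1 * Q m * (Q m * (star (conjM g.1) * Q m))
        = Q m * conjM g.1 * (Q m * Q m) * star (conjM g.1) * Q m := by simp only [mul_assoc]
      _ = -(Q m * (conjM g.1 * star (conjM g.1)) * Q m) := by
        rw [Q_mul_Q]; simp only [mul_neg, neg_mul, mul_one, mul_assoc]
      _ = 1 := by rw [h, mul_one, Q_mul_Q, neg_neg]⟩

/-- A smooth principal `U(n)`-bundle with total space `P` over `X`. -/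
structure PrincipalBundle (n d k : ℕ) (X P : Type*)
    [TopologicalSpace X] [ChartedSpace (EuclideanSpace ℝ (Fin d)) X]
    [TopologicalSpace P] [ChartedSpace (EuclideanSpace ℝ (Fin k)) P] where
  /-- The bundle projection. -/
  proj : P → X
  contMDiff_proj : ContMDiff (𝓡 k) (𝓡 d) ∞ proj
  /-- The right action `(p, g) ↦ p · g`. -/
  act : P → U n → P
  act_one : ∀ p, act p 1 = p
  act_mul : ∀ p g h, act (act p g) h = act p (g * h)
  contMDiff_act : ContMDiff ((𝓡 k).prod 𝓘(ℝ, u n)) (𝓡 k) ∞ (fun q : P × U n => act q.1 q.2)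
  /-- Every fibre is an orbit. -/
  fiber_eq_orbit : ∀ x, ∃ p, proj ⁻¹' {x} = range (act p)
  /-- Local triviality: near every point of `X` there is a fibre preserving and equivariant
  diffeomorphism from the part of `P` over an open set `V` onto `V × U(n)`. -/
  locally_trivial : ∀ x, ∃ V : Set X, IsOpen V ∧ x ∈ V ∧
    ∃ h : OpenPartialHomeomorph P (X × U n),
      h.source = proj ⁻¹' V ∧ h.target = V ×ˢ univ ∧
      ContMDiffOn (𝓡 k) ((𝓡 d).prod 𝓘(ℝ, u n)) ∞ h h.source ∧
      ContMDiffOn ((𝓡 d).prod 𝓘(ℝ, u n)) (𝓡 k) ∞ h.symm h.target ∧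
      (∀ p ∈ h.source, (h p).1 = proj p) ∧
      (∀ p ∈ h.source, ∀ g, h (act p g) = ((h p).1, (h p).2 * g))

section Bundle

variable {n d k : ℕ} {X P : Type*}
  [TopologicalSpace X] [ChartedSpace (EuclideanSpace ℝ (Fin d)) X]
  [TopologicalSpace P] [ChartedSpace (EuclideanSpace ℝ (Fin k)) P]

namespace PrincipalBundle

variable (B : PrincipalBundle n d k X P)

/-- The fibre `P_x`. -/
abbrev fiber (x : X) : Type _ := {p : P // B.proj p = x}

theorem fiber_nonempty (x : X) : Nonempty (B.fiber x) := by
  obtain ⟨p, hp⟩ := B.fiber_eq_orbit x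
  exact ⟨⟨p, (hp ▸ ⟨1, B.act_one p⟩ : p ∈ B.proj ⁻¹' {x})⟩⟩

theorem exists_act_eq {p q : P} (h : B.proj q = B.proj p) : ∃ g, q = B.act p g := by
  obtain ⟨r, hr⟩ := B.fiber_eq_orbit (B.proj p)
  obtain ⟨a, ha⟩ : p ∈ range (B.act r) := hr ▸ rfl
  obtain ⟨b, hb⟩ : q ∈ range (B.act r) := hr ▸ h
  exact ⟨a⁻¹ * b, by rw [← ha, ← hb, B.act_mul, mul_inv_cancel_left]⟩

theorem act_left_cancel {p : P} {g h : U n} (e : B.act p g = B.act p h) : g = h := by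
  obtain ⟨V, -, hx, f, hs, -, -, -, -, hf⟩ := B.locally_trivial (B.proj p)
  have hp : p ∈ f.source := hs ▸ hx
  have := congrArg Prod.snd (congrArg f e)
  rw [hf p hp, hf p hp] at this
  exact mul_left_cancel this

/-- The fundamental vertical vector at `p` generated by `ξ ∈ u(n)`: the velocity at `t = 0` of the
curve `t ↦ p · exp (t ξ)`, which passes through `p` at `t = 0`. -/
def fundamentalVector (p : P) (ξ : u n) : TangentSpace (𝓡 k) p :=
  mfderiv 𝓘(ℝ, ℝ) (𝓡 k) (fun t : ℝ => B.act p (expU (t • ξ))) 0 (1 : ℝ)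

end PrincipalBundle

/-- A connection 1-form on a principal `U(n)`-bundle: a smooth `u(n)`-valued 1-form on the total
space that reproduces the generators of the fundamental vector fields and satisfies
`R_g^* Ω = Ad(g⁻¹) ∘ Ω`. -/
structure Connection [IsManifold (𝓡 k) ∞ P] (B : PrincipalBundle n d k X P) where
  /-- The underlying 1-form. -/
  form : ∀ p : P, TangentSpace (𝓡 k) p →L[ℝ] u n
  smooth : ContMDiff (𝓡 k).tangent 𝓘(ℝ, u n) ∞
    (fun v : TangentBundle (𝓡 k) P => form v.proj v.2)
  form_fundamentalVector : ∀ p ξ, form p (B.fundamentalVector p ξ) = ξ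
  form_act : ∀ (g : U n) (p : P) (v : TangentSpace (𝓡 k) p),
    (form (B.act p g) (mfderiv (𝓡 k) (𝓡 k) (fun q => B.act q g) p v) :
        Matrix (Fin n) (Fin n) ℂ) =
      ((g⁻¹ : U n) : Matrix (Fin n) (Fin n) ℂ) * form p v * g

end Bundle


/-- The curve `c : [0,1] → M`, seen as a map on `ℝ` that is constant on `(-∞, 0]` and on
`[1, ∞)`. -/
def extend {M : Type*} (c : unitInterval → M) : ℝ → M := IccExtend zero_le_one c

/-- `0 = t 0 < t 1 < ... < t N = 1` is a partition of `[0,1]` such that `c` is `C¹` on each of the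
closed intervals `[t i, t (i+1)]`. -/
structure IsC1Partition (d : ℕ) {M : Type*} [TopologicalSpace M]
    [ChartedSpace (EuclideanSpace ℝ (Fin d)) M] (c : unitInterval → M) (N : ℕ) (t : ℕ → ℝ) : Prop where
  zero : t 0 = 0
  one : t N = 1
  lt : ∀ i < N, t i < t (i + 1)
  contMDiffOn : ∀ i < N, ContMDiffOn 𝓘(ℝ, ℝ) (𝓡 d) 1 (extend c) (Icc (t i) (t (i + 1)))

/-- Piecewise `C¹` curves `[0,1] → M` (these are continuous). -/
def IsPiecewiseC1 (d : ℕ) {M : Type*} [TopologicalSpace M]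
    [ChartedSpace (EuclideanSpace ℝ (Fin d)) M] (c : unitInterval → M) : Prop :=
  ∃ N t, IsC1Partition d c N t

section Transport

variable {n d k : ℕ} {X P : Type*}
  [TopologicalSpace X] [ChartedSpace (EuclideanSpace ℝ (Fin d)) X]
  [TopologicalSpace P] [ChartedSpace (EuclideanSpace ℝ (Fin k)) P] [IsManifold (𝓡 k) ∞ P]
  {B : PrincipalBundle n d k X P} (Ω : Connection B)

namespace Connection

/-- A horizontal curve: a piecewise `C¹` curve in `P` all of whose tangent vectors (one-sided ones
at the break points) are annihilated by the connection form. -/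
def IsHorizontal (γ : unitInterval → P) : Prop :=
  ∃ N t, IsC1Partition k γ N t ∧ ∀ i < N, ∀ s ∈ Icc (t i) (t (i + 1)),
    Ω.form (extend γ s)
      (mfderivWithin 𝓘(ℝ, ℝ) (𝓡 k) (extend γ) (Icc (t i) (t (i + 1))) s (1 : ℝ)) = 0

/-- `γ` is a horizontal lift of the curve `c` in the base. -/
def IsHorizontalLift (c : unitInterval → X) (γ : unitInterval → P) : Prop :=
  Ω.IsHorizontal γ ∧ ∀ s, B.proj (γ s) = c s

open Classical in
/-- Parallel transport along `c`: the point `p` of the fibre over `c 0` is sent to the endpoint of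
the horizontal lift of `c` starting at `p`. (The default value is used only if there is no such
lift, which does not happen for piecewise `C¹` curves.) -/
def PT (c : unitInterval → X) (p : B.fiber (c 0)) : B.fiber (c 1) :=
  if h : ∃ γ, Ω.IsHorizontalLift c γ ∧ γ 0 = p then
    ⟨h.choose 1, h.choose_spec.1.2 1⟩
  else
    (B.fiber_nonempty (c 1)).some

theorem exists_PT_eq {c : unitInterval → X} (hc : c 0 = c 1) (p : B.fiber (c 0)) :
    ∃ g, (Ω.PT c p : P) = B.act p g :=
  B.exists_act_eq (by rw [(Ω.PT c p).2, p.2, hc])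

/-- The holonomy map of the loop `c`: the element `g` of `U(n)` such that `PT_c(p) = p · g`. -/
def hol (c : unitInterval → X) (hc : c 0 = c 1) (p : B.fiber (c 0)) : U n :=
  (Ω.exists_PT_eq hc p).choose

end Connection

/-- The properties shared by both kinds of time-reversal structure over `(X, τ)`: `Θ` is a smooth
involution of the total space which covers `τ`. -/
structure IsInvolutiveLift (B : PrincipalBundle n d k X P) (τ : X → X) (Θ : P → P) : Prop where
  smooth : ContMDiff (𝓡 k) (𝓡 k) ∞ Θ
  proj_apply : ∀ p, B.proj (Θ p) = τ (B.proj p)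
  involutive : ∀ p, Θ (Θ p) = p

/-- The map `P_x → P_{τ x}` induced by `Θ` on the fibres. -/
def IsInvolutiveLift.onFiber {τ : X → X} {Θ : P → P} (h : IsInvolutiveLift B τ Θ) (x : X)
    (p : B.fiber x) : B.fiber (τ x) :=
  ⟨Θ p, by rw [h.proj_apply, p.2]⟩

/-- A "Real" structure on a principal `U(n)`-bundle: `Θ (p · g) = Θ p · ḡ`. -/
structure IsRealStructure (B : PrincipalBundle n d k X P) (τ : X → X) (Θ : P → P) : Prop
    extends IsInvolutiveLift B τ Θ where
  apply_act : ∀ p g, Θ (B.act p g) = B.act (Θ p) (conjU g)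

/-- A "Quaternionic" structure on a principal `U(2m)`-bundle: `Θ (p · g) = Θ p · σ(g)`, where
`σ(g) = -Q ḡ Q`. -/
structure IsQuaternionicStructure {m : ℕ} (B : PrincipalBundle (2 * m) d k X P) (τ : X → X)
    (Θ : P → P) : Prop extends IsInvolutiveLift B τ Θ where
  apply_act : ∀ p g, Θ (B.act p g) = B.act (Θ p) (sigmaU g)

/-- "Real" connections: the complex conjugate of `Θ^* Ω` is `Ω`. -/
def IsRealConnection (Θ : P → P) : Prop :=
  ∀ (p : P) (v : TangentSpace (𝓡 k) p),
    conjM (Ω.form (Θ p) (mfderiv (𝓡 k) (𝓡 k) Θ p v) : Matrix (Fin n) (Fin n) ℂ) = Ω.form p v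

/-- "Quaternionic" connections: `Θ^* σ(Ω) = Ω`, where `σ(Ω) = -Q Ω̄ Q`. -/
def IsQuaternionicConnection {m : ℕ} {B : PrincipalBundle (2 * m) d k X P} (Ω : Connection B)
    (Θ : P → P) : Prop :=
  ∀ (p : P) (v : TangentSpace (𝓡 k) p),
    sigmaM (Ω.form (Θ p) (mfderiv (𝓡 k) (𝓡 k) Θ p v) :
      Matrix (Fin (2 * m)) (Fin (2 * m)) ℂ) = Ω.form p v

end Transport

end TimeReversal

end

open scoped Topology

/-! ### Curves in the unitary group, read in the Cayley chart -/

namespace UnitaryLie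

variable {A : Type*} [CStarAlgebra A]

/-! Equivariance of `Ω` says that `Ω` is recovered from its pullback along `Θ` by applying `conjM`
or `sigmaM`. Both maps have trivial kernel, so the differential of `Θ` preserves the horizontal
vectors `ker Ω`. As `Θ` also covers `τ`, it carries the horizontal lift of `c` from `p` to a
horizontal lift of `τ ∘ c` from `Θ p` (`IsHorizontalLift.comp`). Uniqueness of lifts then identifies
the endpoints, which is the commutation of `PT` with `Θ`. Applying `Θ` to `PT_c(p) = p · h` and
using that the action is free gives the holonomy formula.

The bulk of the work is existence and uniqueness of horizontal lifts. Both rest on the product rule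
`exists_hasMFDerivWithinAt_act`: Ω((γ g)') = g⁻¹ Ω(γ') g + g⁻¹ g'. Uniqueness: two lifts of one
curve differ by a curve `g` in `U(n)`. If both are horizontal the formula leaves g⁻¹ g' = 0, so `g`
is constant. Existence: over a trivialising open set, lift the curve to some `q` by a local section,
and solve the linear equation g' = -Ω(q') g in the unitary group (`exists_unitary_solution`); then
`q g` is horizontal. The short lifts are concatenated by compactness of the parameter interval. -/

/-- The derivative at `1` of the Cayley chart, as a map on the ambient algebra. -/
noncomputable def cayleyDeriv (A : Type*) [CStarAlgebra A] : A →L[ℝ] skew A :=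
  skewPart.comp (fderiv ℝ (cayley : A → A) 1)

/-- A curve in the unitary group that is differentiable in the ambient algebra is differentiable
as a curve in the Lie group; its derivative is expressed in the Cayley chart. -/
theorem hasMFDerivWithinAt_of_coe {g : ℝ → unitary A} {D : A} {S : Set ℝ} {s : ℝ}
    (h : HasDerivWithinAt (fun t => (g t : A)) D S s) :
    HasMFDerivWithinAt 𝓘(ℝ, ℝ) 𝓘(ℝ, skew A) g S s
      (ContinuousLinearMap.toSpanSingleton ℝ
        (cayleyDeriv A (((g s)⁻¹ : unitary A) * D)) : ℝ →L[ℝ] skew A) := by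
  refine ⟨Topology.IsInducing.subtypeVal.continuousWithinAt_iff.2 h.continuousWithinAt, ?_⟩
  have h1 : HasDerivWithinAt (fun t => (((g s)⁻¹ * g t : unitary A) : A))
      (((g s)⁻¹ : unitary A) * D) S s := by
    simpa using h.const_mul (((g s)⁻¹ : unitary A) : A)
  have hu : IsUnit ((1 : A) + 1) := by rw [one_add_one_eq_two]; exact isUnit_two
  -- The chart at `g s` first translates by `(g s)⁻¹`, so only the derivative of `cayley` at `1`
  -- enters.
  have h2 : HasFDerivAt (cayley : A → A) (fderiv ℝ cayley 1) (((g s)⁻¹ * g s : unitary A) : A) := by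
    rw [inv_mul_cancel]
    exact ((contDiffAt_cayley (n := 1) hu).differentiableAt one_ne_zero).hasFDerivAt
  have h3 := (skewPart (A := A)).hasFDerivAt.comp_hasDerivWithinAt s (h2.comp_hasDerivWithinAt s h1)
  have h4 := h3.hasFDerivWithinAt
  simp only [mfld_simps, inter_univ]
  refine (h4.congr (fun t _ => ?_) ?_)
  · exact (skewPart_coe _).symm
  · exact (skewPart_coe _).symm

end UnitaryLie

namespace TimeReversal

theorem coe_inv_mul_coe {n : ℕ} (g : U n) :
    ((g⁻¹ : U n) : Matrix (Fin n) (Fin n) ℂ) * g = 1 := by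
  rw [← Submonoid.coe_mul, inv_mul_cancel, OneMemClass.coe_one]

theorem coe_mul_coe_inv {n : ℕ} (g : U n) :
    (g : Matrix (Fin n) (Fin n) ℂ) * (g⁻¹ : U n) = 1 := by
  rw [← Submonoid.coe_mul, mul_inv_cancel, OneMemClass.coe_one]

/-! ### The connection form along the group action -/

section Bundle

variable {n d k : ℕ} {X P : Type*}
  [TopologicalSpace X] [ChartedSpace (EuclideanSpace ℝ (Fin d)) X]
  [TopologicalSpace P] [ChartedSpace (EuclideanSpace ℝ (Fin k)) P]

namespace PrincipalBundle

variable (B : PrincipalBundle n d k X P)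

theorem proj_act (p : P) (g : U n) : B.proj (B.act p g) = B.proj p := by
  obtain ⟨r, hr⟩ := B.fiber_eq_orbit (B.proj p)
  obtain ⟨a, ha⟩ : p ∈ range (B.act r) := hr ▸ rfl
  have : B.act r (a * g) ∈ B.proj ⁻¹' {B.proj p} := hr ▸ mem_range_self _
  rw [← B.act_mul, ha] at this
  exact this

theorem contMDiff_act_right (p : P) : ContMDiff 𝓘(ℝ, u n) (𝓡 k) ∞ (B.act p) :=
  B.contMDiff_act.comp (contMDiff_const.prodMk contMDiff_id)

/-- The derivative of an orbit map maps the generator `ξ`, read in the Cayley chart at `g`, to the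
fundamental vector of `ξ`. -/
theorem mfderiv_act_right (p : P) (g : U n) (ξ : u n) :
    (mfderiv 𝓘(ℝ, u n) (𝓡 k) (B.act p) g
      (UnitaryLie.cayleyDeriv _ (ξ : Matrix (Fin n) (Fin n) ℂ)) : EuclideanSpace ℝ (Fin k)) =
      B.fundamentalVector (B.act p g) ξ := by
  -- The chain rule below produces the base point `g * expU (0 • ξ)`, which equals `g` only
  -- propositionally.
  have h0 : g * expU ((0 : ℝ) • ξ) = g := by
    apply Subtype.ext
    simp [expU]
  have h : HasDerivWithinAt (fun t : ℝ => ((g * expU (t • ξ) : U n) : Matrix (Fin n) (Fin n) ℂ))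
      ((g : Matrix (Fin n) (Fin n) ℂ) * ξ) univ 0 := by
    have := (hasDerivAt_exp_smul_const (𝕂 := ℝ) (ξ : Matrix (Fin n) (Fin n) ℂ) 0)
    rw [zero_smul, NormedSpace.exp_zero, one_mul] at this
    exact (this.const_mul (g : Matrix (Fin n) (Fin n) ℂ)).hasDerivWithinAt
  have h2 := UnitaryLie.hasMFDerivWithinAt_of_coe h
  have h3 := ((B.contMDiff_act_right p).mdifferentiable (by simp)
    (g * expU ((0 : ℝ) • ξ))).hasMFDerivAt
  have h4 := h3.comp 0 (h2.hasMFDerivAt Filter.univ_mem)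
  have e : (fun t : ℝ => B.act (B.act p g) (expU (t • ξ))) =
      B.act p ∘ fun t : ℝ => g * expU (t • ξ) := by
    funext t
    exact B.act_mul _ _ _
  rw [fundamentalVector, e, h4.mfderiv]
  change _ = mfderiv 𝓘(ℝ, u n) (𝓡 k) (B.act p) (g * expU ((0 : ℝ) • ξ))
    ((1 : ℝ) • (UnitaryLie.cayleyDeriv _
      (((g * expU ((0 : ℝ) • ξ))⁻¹ : U n) * ((g : Matrix (Fin n) (Fin n) ℂ) * ξ))))
  rw [h0, one_smul, ← mul_assoc, coe_inv_mul_coe, one_mul]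

end PrincipalBundle

variable [IsManifold (𝓡 k) ∞ P] {B : PrincipalBundle n d k X P} (Ω : Connection B)

/-- The connection form on the differential of the action. -/
theorem Connection.form_mfderiv_act (p : P) (g : U n) (v : EuclideanSpace ℝ (Fin k)) (ξ : u n) :
    ((Ω.form (B.act p g) (mfderiv ((𝓡 k).prod 𝓘(ℝ, u n)) (𝓡 k)
      (fun q : P × U n => B.act q.1 q.2) (p, g)
      ((v, UnitaryLie.cayleyDeriv _ (ξ : Matrix (Fin n) (Fin n) ℂ)) :
        EuclideanSpace ℝ (Fin k) × u n)) : u n) : Matrix (Fin n) (Fin n) ℂ) =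
      ((g⁻¹ : U n) : Matrix (Fin n) (Fin n) ℂ) * Ω.form p v * g + ξ := by
  have hF := (B.contMDiff_act.mdifferentiable (by simp) (p, g))
  -- Split into partial derivatives: the one in `p` is handled by `form_act`, the one in `g` is a
  -- fundamental vector.
  have hv := mfderiv_prod_eq_add_apply
    (v := ((v, UnitaryLie.cayleyDeriv _ (ξ : Matrix (Fin n) (Fin n) ℂ)) :
        EuclideanSpace ℝ (Fin k) × u n)) hF
  have hsum := hv.trans (congrArg _ (B.mfderiv_act_right p g ξ))
  have hΩ := (congrArg (fun w : EuclideanSpace ℝ (Fin k) => Ω.form (B.act p g) w) hsum).trans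
    (map_add (Ω.form (B.act p g)) _ _)
  rw [Ω.form_fundamentalVector] at hΩ
  refine (congrArg (fun w : u n => (w : Matrix (Fin n) (Fin n) ℂ)) hΩ).trans ?_
  exact congrArg (· + (ξ : Matrix (Fin n) (Fin n) ℂ)) (Ω.form_act g p v)

/-- The connection form along the product of a curve in the total space and a curve in the
structure group. -/
theorem Connection.exists_hasMFDerivWithinAt_act {γ : ℝ → P} {g : ℝ → U n} {S : Set ℝ} {s : ℝ}
    {γ' : TangentSpace 𝓘(ℝ, ℝ) s →L[ℝ] TangentSpace (𝓡 k) (γ s)} {D : Matrix (Fin n) (Fin n) ℂ}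
    (hγ : HasMFDerivWithinAt 𝓘(ℝ, ℝ) (𝓡 k) γ S s γ')
    (hg : HasDerivWithinAt (fun t => (g t : Matrix (Fin n) (Fin n) ℂ)) D S s)
    (hD : ((g s)⁻¹ : U n) * D ∈ u n) :
    ∃ w : TangentSpace 𝓘(ℝ, ℝ) s →L[ℝ] TangentSpace (𝓡 k) (B.act (γ s) (g s)),
      HasMFDerivWithinAt 𝓘(ℝ, ℝ) (𝓡 k) (fun t => B.act (γ t) (g t)) S s w ∧
      (Ω.form _ (w (1 : ℝ)) : Matrix (Fin n) (Fin n) ℂ) =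
        ((g s)⁻¹ : U n) * Ω.form _ (γ' (1 : ℝ)) * g s + ((g s)⁻¹ : U n) * D := by
  have hF := (B.contMDiff_act.mdifferentiable (by simp) (γ s, g s))
  have hG := UnitaryLie.hasMFDerivWithinAt_of_coe hg
  refine ⟨_, hF.hasMFDerivAt.comp_hasMFDerivWithinAt s (hγ.prodMk hG), ?_⟩
  refine Eq.trans ?_ (Ω.form_mfderiv_act (γ s) (g s) (γ' (1 : ℝ)) ⟨_, hD⟩)
  change ((Ω.form (B.act (γ s) (g s)) (mfderiv ((𝓡 k).prod 𝓘(ℝ, u n)) (𝓡 k)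
    (fun q : P × U n => B.act q.1 q.2) (γ s, g s) ((γ' (1 : ℝ),
    (1 : ℝ) • UnitaryLie.cayleyDeriv _ (((g s)⁻¹ : U n) * D)) :
        EuclideanSpace ℝ (Fin k) × u n)) : u n) : Matrix (Fin n) (Fin n) ℂ) = _
  rw [one_smul]

end Bundle

/-! ### Regularity of the group-valued curve relating two curves -/

section Bundle

variable {n d k : ℕ} {X P : Type*}
  [TopologicalSpace X] [ChartedSpace (EuclideanSpace ℝ (Fin d)) X]
  [TopologicalSpace P] [ChartedSpace (EuclideanSpace ℝ (Fin k)) P]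

namespace PrincipalBundle

variable (B : PrincipalBundle n d k X P)

/-- Near every point of the total space there is a smooth equivariant map to the structure
group. -/
theorem exists_equivariant_map (p : P) : ∃ W : Set P, IsOpen W ∧ p ∈ W ∧ ∃ Ψ : P → U n,
    ContMDiffOn (𝓡 k) 𝓘(ℝ, u n) ∞ Ψ W ∧ ∀ q ∈ W, ∀ g, B.act q g ∈ W ∧ Ψ (B.act q g) = Ψ q * g := by
  obtain ⟨V, -, hx, f, hs, -, hf, -, -, he⟩ := B.locally_trivial (B.proj p)
  refine ⟨f.source, f.open_source, hs ▸ hx, fun q => (f q).2,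
    contMDiff_snd.comp_contMDiffOn hf, fun q hq g => ⟨?_, congrArg Prod.snd (he q hq g)⟩⟩
  rw [hs] at hq ⊢
  simpa [B.proj_act] using hq

variable {B} {f₁ f₂ : ℝ → P} {g : ℝ → U n} {S : Set ℝ} {s : ℝ}

/-- A local equivariant map `Ψ` turns `f₂ = f₁ · g` into `Ψ f₂ = Ψ f₁ * g`, which can be solved for
`g`. Hence `g`, which is merely chosen pointwise, inherits the regularity of `f₁` and `f₂`. -/
theorem exists_eventuallyEq_inv_mul (hf : ∀ t, f₂ t = B.act (f₁ t) (g t))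
    (h₁ : ContinuousWithinAt f₁ S s) : ∃ Ψ : P → U n,
      ContMDiffAt (𝓡 k) 𝓘(ℝ, u n) ∞ Ψ (f₁ s) ∧ ContMDiffAt (𝓡 k) 𝓘(ℝ, u n) ∞ Ψ (f₂ s) ∧
      g =ᶠ[𝓝[S] s] (fun t => (Ψ (f₁ t))⁻¹ * Ψ (f₂ t)) ∧ g s = (Ψ (f₁ s))⁻¹ * Ψ (f₂ s) := by
  obtain ⟨W, hW, hp, Ψ, hΨ, he⟩ := B.exists_equivariant_map (f₁ s)
  have key : ∀ t, f₁ t ∈ W → g t = (Ψ (f₁ t))⁻¹ * Ψ (f₂ t) := fun t ht => by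
    rw [hf, (he _ ht _).2, inv_mul_cancel_left]
  refine ⟨Ψ, hΨ.contMDiffAt (hW.mem_nhds hp),
    hΨ.contMDiffAt (hW.mem_nhds (hf s ▸ (he _ hp _).1)), ?_, key s hp⟩
  filter_upwards [h₁.preimage_mem_nhdsWithin (hW.mem_nhds hp)] with t ht using key t ht

theorem continuousWithinAt_of_act (hf : ∀ t, f₂ t = B.act (f₁ t) (g t))
    (h₁ : ContinuousWithinAt f₁ S s) (h₂ : ContinuousWithinAt f₂ S s) :
    ContinuousWithinAt g S s := by
  obtain ⟨Ψ, hΨ₁, hΨ₂, he, hs⟩ := exists_eventuallyEq_inv_mul hf h₁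
  exact ((hΨ₁.continuousAt.comp_continuousWithinAt h₁).inv.mul
    (hΨ₂.continuousAt.comp_continuousWithinAt h₂)).congr_of_eventuallyEq he hs

theorem differentiableWithinAt_of_act (hf : ∀ t, f₂ t = B.act (f₁ t) (g t))
    (h₁ : MDifferentiableWithinAt 𝓘(ℝ, ℝ) (𝓡 k) f₁ S s)
    (h₂ : MDifferentiableWithinAt 𝓘(ℝ, ℝ) (𝓡 k) f₂ S s) :
    DifferentiableWithinAt ℝ (fun t => (g t : Matrix (Fin n) (Fin n) ℂ)) S s := by
  obtain ⟨Ψ, hΨ₁, hΨ₂, he, hs⟩ := exists_eventuallyEq_inv_mul hf h₁.continuousWithinAt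
  have hc : ∀ {p : P}, ContMDiffAt (𝓡 k) 𝓘(ℝ, u n) ∞ Ψ p →
      MDifferentiableAt (𝓡 k) 𝓘(ℝ, Matrix (Fin n) (Fin n) ℂ)
        (fun q => (Ψ q : Matrix (Fin n) (Fin n) ℂ)) p := fun {p} h =>
    (ContMDiffAt.comp p UnitaryLie.contMDiff_coe.contMDiffAt h).mdifferentiableAt (by simp)
  have d₁ := ((hc hΨ₁).comp_mdifferentiableWithinAt s h₁).differentiableWithinAt
  have d₂ := ((hc hΨ₂).comp_mdifferentiableWithinAt s h₂).differentiableWithinAt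
  -- The inverse of a unitary matrix is its adjoint.
  refine (d₁.star.mul d₂).congr_of_eventuallyEq ?_ ?_
  · filter_upwards [he] with t ht
    rw [ht]; rfl
  · rw [hs]; rfl

end PrincipalBundle

/-- The logarithmic derivative of a curve of unitary matrices is anti-Hermitian. -/
theorem inv_mul_deriv_mem {g : ℝ → U n} {D : Matrix (Fin n) (Fin n) ℂ} {S : Set ℝ} {s : ℝ}
    (hS : UniqueDiffWithinAt ℝ S s)
    (hg : HasDerivWithinAt (fun t => (g t : Matrix (Fin n) (Fin n) ℂ)) D S s) :
    ((g s)⁻¹ : U n) * D ∈ u n := by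
  -- Differentiate `g* g = 1`.
  have h1 : (fun t => star (g t : Matrix (Fin n) (Fin n) ℂ) * g t) = fun _ => 1 := by
    funext t; exact Unitary.coe_star_mul_self (g t)
  have h2 := hg.star.mul hg
  have h3 : HasDerivWithinAt (fun t => star (g t : Matrix (Fin n) (Fin n) ℂ) * g t) 0 S s := by
    rw [h1]; exact hasDerivWithinAt_const _ _ _
  have h4 := hS.eq_deriv _ h2 h3
  change _ ∈ skewAdjoint _
  rw [skewAdjoint.mem_iff]
  change star (star (g s : Matrix (Fin n) (Fin n) ℂ) * D) =
    -(star (g s : Matrix (Fin n) (Fin n) ℂ) * D)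
  rw [star_mul, star_star]
  exact eq_neg_of_add_eq_zero_left h4

end Bundle

/-! ### Partitions of the parameter interval -/

section Partition

theorem extend_of_mem {M : Type*} (c : unitInterval → M) {s : ℝ} (hs : s ∈ Icc (0 : ℝ) 1) :
    extend c s = c ⟨s, hs⟩ := IccExtend_of_mem _ _ hs

theorem extend_coe {M : Type*} (c : unitInterval → M) (s : unitInterval) :
    extend c s = c s := IccExtend_val _ _ s

theorem extend_comp {M M' : Type*} (f : M → M') (c : unitInterval → M) :
    extend (f ∘ c) = f ∘ extend c := rfl

theorem exists_mem_Ico_of_partition {t : ℕ → ℝ} {N : ℕ} {s : ℝ} (hs : s ∈ Ico (t 0) (t N)) :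
    ∃ i < N, s ∈ Ico (t i) (t (i + 1)) := by
  induction N with
  | zero => exact absurd (hs.1.trans_lt hs.2) (lt_irrefl _)
  | succ N ih =>
    by_cases h : s < t N
    · obtain ⟨i, hi, h⟩ := ih ⟨hs.1, h⟩
      exact ⟨i, by omega, h⟩
    · exact ⟨N, by omega, not_lt.1 h, hs.2⟩

theorem le_of_partition {t : ℕ → ℝ} {N : ℕ} (h : ∀ i < N, t i < t (i + 1)) {i j : ℕ} (hij : i ≤ j)
    (hj : j ≤ N) : t i ≤ t j := by
  induction j, hij using Nat.le_induction with
  | base => exact le_rfl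
  | succ j _ ih => exact (ih (by omega)).trans (h j (by omega)).le

variable {d : ℕ} {M : Type*} [TopologicalSpace M] [ChartedSpace (EuclideanSpace ℝ (Fin d)) M]
  {c : unitInterval → M} {N : ℕ} {t : ℕ → ℝ}

theorem IsC1Partition.continuousOn (h : IsC1Partition d c N t) :
    ContinuousOn (extend c) (Icc 0 1) := by
  have : ∀ j ≤ N, ContinuousOn (extend c) (Icc 0 (t j)) := fun j hj => by
    induction j with
    | zero => rw [h.zero, Icc_self]; exact continuousOn_singleton _ _
    | succ j ih =>
      rw [← Icc_union_Icc_eq_Icc (b := t j) (h.zero ▸ le_of_partition h.lt (Nat.zero_le j) (by omega))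
        (h.lt j hj).le]
      exact (ih (by omega)).union_of_isClosed (h.contMDiffOn j hj).continuousOn isClosed_Icc
        isClosed_Icc
  exact h.one ▸ this N le_rfl

end Partition

/-! ### Uniqueness of horizontal lifts -/

section Transport

variable {n d k : ℕ} {X P : Type*}
  [TopologicalSpace X] [ChartedSpace (EuclideanSpace ℝ (Fin d)) X]
  [TopologicalSpace P] [ChartedSpace (EuclideanSpace ℝ (Fin k)) P] [IsManifold (𝓡 k) ∞ P]
  {B : PrincipalBundle n d k X P} {Ω : Connection B}

namespace Connection

theorem IsHorizontal.continuousOn {γ : unitInterval → P} (h : Ω.IsHorizontal γ) :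
    ContinuousOn (extend γ) (Icc 0 1) := by
  obtain ⟨N, t, ht, -⟩ := h
  exact ht.continuousOn

/-- One-sided derivatives remove the special role of the break points: each `s < 1` lies in a
half-open piece `[t i, t (i+1))`, which is a right neighbourhood of `s` in `Ici s`. -/
theorem IsHorizontal.exists_right_deriv {γ : unitInterval → P} (h : Ω.IsHorizontal γ) {s : ℝ}
    (hs : s ∈ Ico (0 : ℝ) 1) :
    ∃ v : TangentSpace 𝓘(ℝ, ℝ) s →L[ℝ] TangentSpace (𝓡 k) (extend γ s),
      HasMFDerivWithinAt 𝓘(ℝ, ℝ) (𝓡 k) (extend γ) (Ici s) s v ∧ Ω.form _ (v (1 : ℝ)) = 0 := by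
  obtain ⟨N, t, ht, h0⟩ := h
  rw [← ht.zero, ← ht.one] at hs
  obtain ⟨i, hi, hsi⟩ := exists_mem_Ico_of_partition hs
  refine ⟨_, ?_, h0 i hi s (Ico_subset_Icc_self hsi)⟩
  have h1 := ((ht.contMDiffOn i hi).mdifferentiableOn (by simp) s
    (Ico_subset_Icc_self hsi)).hasMFDerivWithinAt
  exact h1.mono_of_mem_nhdsWithin
    (Filter.mem_of_superset (Icc_mem_nhdsGE hsi.2) (Icc_subset_Icc_left hsi.1))

/-- Horizontal lifts are determined by their starting point. -/
theorem IsHorizontalLift.eq {c : unitInterval → X} {γ₁ γ₂ : unitInterval → P}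
    (h₁ : Ω.IsHorizontalLift c γ₁) (h₂ : Ω.IsHorizontalLift c γ₂) (h0 : γ₁ 0 = γ₂ 0) :
    γ₁ = γ₂ := by
  have hex : ∀ s, ∃ g, extend γ₂ s = B.act (extend γ₁ s) g := fun s =>
    B.exists_act_eq ((h₂.2 _).trans (h₁.2 _).symm)
  choose g hg using hex
  have hcont : ContinuousOn (fun s => (g s : Matrix (Fin n) (Fin n) ℂ)) (Icc 0 1) := fun s hs =>
    continuous_subtype_val.continuousAt.comp_continuousWithinAt
      (PrincipalBundle.continuousWithinAt_of_act hg (h₁.1.continuousOn s hs)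
        (h₂.1.continuousOn s hs))
  have hderiv : ∀ s ∈ Ico (0 : ℝ) 1,
      HasDerivWithinAt (fun s => (g s : Matrix (Fin n) (Fin n) ℂ)) 0 (Ici s) s := fun s hs => by
    obtain ⟨v₁, hv₁, e₁⟩ := h₁.1.exists_right_deriv hs
    obtain ⟨v₂, hv₂, e₂⟩ := h₂.1.exists_right_deriv hs
    have hd := (PrincipalBundle.differentiableWithinAt_of_act hg hv₁.mdifferentiableWithinAt
      hv₂.mdifferentiableWithinAt).hasDerivWithinAt
    have hU := uniqueDiffOn_Ici s s self_mem_Ici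
    obtain ⟨w, hw, hΩ⟩ := Ω.exists_hasMFDerivWithinAt_act hv₁ hd (inv_mul_deriv_mem hU hd)
    rw [← funext hg] at hw
    -- `v₂` and `w` are both derivatives of `extend γ₂` within `Ici s`, once directly and once by
    -- the product rule.
    have hvw : (v₂ : ℝ →L[ℝ] EuclideanSpace ℝ (Fin k)) = w :=
      UniqueMDiffWithinAt.eq (uniqueMDiffWithinAt_iff_uniqueDiffWithinAt.2 hU) hv₂ hw
    have e₃ : Ω.form (B.act (extend γ₁ s) (g s)) (w (1 : ℝ)) = 0 := by
      rw [← hg s]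
      exact (congrArg (fun v : ℝ →L[ℝ] EuclideanSpace ℝ (Fin k) =>
        Ω.form (extend γ₂ s) (v 1)) hvw).symm.trans e₂
    -- With both lifts horizontal the product rule reduces to `0 = g⁻¹ g'`.
    rw [e₁, e₃] at hΩ
    simp only [ZeroMemClass.coe_zero, mul_zero, zero_mul, zero_add] at hΩ
    have := congrArg (fun a => (g s : Matrix (Fin n) (Fin n) ℂ) * a) hΩ.symm
    simp only [← mul_assoc, coe_mul_coe_inv, one_mul, mul_zero] at this
    rwa [this] at hd
  have hconst := constant_of_has_deriv_right_zero hcont hderiv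
  have hg0 : g 0 = 1 := by
    apply B.act_left_cancel (p := extend γ₁ 0)
    rw [← hg, B.act_one, show (0 : ℝ) = ((0 : unitInterval) : ℝ) from rfl, extend_coe, extend_coe,
      h0]
  funext s
  have hs : g s = 1 := by rw [← hg0]; exact Subtype.ext (hconst s s.2)
  rw [← extend_coe γ₁, ← extend_coe γ₂, hg, hs, B.act_one]

end Connection

end Transport

end TimeReversal
-- Existence of horizontal lifts
namespace UnitaryLie

theorem norm_coe_le_one {A : Type*} [CStarAlgebra A] (g : unitary A) : ‖(g : A)‖ ≤ 1 := by
  -- In the zero algebra, such as matrices of size 0, unitaries have norm 0.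
  rcases subsingleton_or_nontrivial A with h | h
  · rw [Subsingleton.elim (g : A) 0, norm_zero]; exact zero_le_one
  · exact (CStarRing.norm_coe_unitary g).le

end UnitaryLie

namespace TimeReversal

/-- Short-time existence for the equation `g' = -a g` in the unitary group. The time depends only
on a bound for the coefficient. -/
theorem exists_unitary_solution {n : ℕ} {a b : ℝ} (hab : a ≤ b) {α : ℝ → u n} {K : ℝ}
    (hα : ContinuousOn α (Icc a b)) (hK : ∀ t ∈ Icc a b, ‖α t‖ ≤ K) (hK' : 2 * K * (b - a) ≤ 1)
    (g₀ : U n) : ∃ g : ℝ → U n, g a = g₀ ∧ ∀ t ∈ Icc a b,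
      HasDerivWithinAt (fun t => (g t : Matrix (Fin n) (Fin n) ℂ))
        (-((α t : Matrix (Fin n) (Fin n) ℂ) * g t)) (Icc a b) t := by
  have hK0 : 0 ≤ K := (norm_nonneg _).trans (hK a (left_mem_Icc.2 hab))
  lift K to NNReal using hK0
  have hα' : ContinuousOn (fun t => (α t : Matrix (Fin n) (Fin n) ℂ)) (Icc a b) :=
    continuous_subtype_val.comp_continuousOn hα
  -- On the ball of radius 1 about `g₀` one has `‖x‖ ≤ 2`, so the field is bounded by `2 * K`. The
  -- solution stays in the ball for times up to `1 / (2 * K)`, which is the hypothesis `hK'`.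
  have hPL : IsPicardLindelof (fun t (x : Matrix (Fin n) (Fin n) ℂ) => -((α t).1 * x))
      (⟨a, left_mem_Icc.2 hab⟩ : Icc a b) (g₀ : Matrix (Fin n) (Fin n) ℂ) 1 0
      (2 * K) K := by
    constructor
    · intro t ht
      refine LipschitzOnWith.of_dist_le_mul fun x _ y _ => ?_
      rw [dist_neg_neg, dist_eq_norm, dist_eq_norm, ← mul_sub]
      exact (norm_mul_le _ _).trans (mul_le_mul_of_nonneg_right (hK t ht) (norm_nonneg _))
    · intro x _
      exact (hα'.mul continuousOn_const).neg
    · intro t ht x hx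
      have h1 : ‖x‖ ≤ 2 := by
        have h2 := norm_sub_norm_le x (g₀ : Matrix (Fin n) (Fin n) ℂ)
        have h3 := mem_closedBall_iff_norm.1 hx
        have h4 := UnitaryLie.norm_coe_le_one g₀
        simp only [NNReal.coe_one] at h3
        linarith
      rw [norm_neg]
      calc ‖(α t).1 * x‖ ≤ ‖(α t).1‖ * ‖x‖ := norm_mul_le _ _
        _ ≤ K * 2 := mul_le_mul (hK t ht) h1 (norm_nonneg _) K.2
        _ = _ := by simp [mul_comm]
    · have : max (b - a) (a - a) = b - a := max_eq_left (by linarith)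
      simpa only [this, NNReal.coe_mul, NNReal.coe_ofNat, NNReal.coe_one, NNReal.coe_zero, sub_zero]
        using hK'
  obtain ⟨x, hx0, hx⟩ := hPL.exists_eq_forall_mem_Icc_hasDerivWithinAt₀
  -- The flow preserves unitarity: as `α` is anti-Hermitian, the derivative of `x* x` is `x* α x -
  -- x* α x = 0`.
  have hx1 : ∀ t ∈ Icc a b, star (x t) * x t = 1 := fun t ht => by
    have h := constant_of_has_deriv_right_zero (f := fun t => star (x t) * x t) (a := a) (b := b)
      (fun s hs => ((hx s hs).star.mul (hx s hs)).continuousWithinAt) (fun s hs => ?_) t ht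
    · rw [h]
      simp only at hx0
      rw [hx0]
      exact Unitary.coe_star_mul_self g₀
    · have h1 := (hx s (Ico_subset_Icc_self hs)).mono_of_mem_nhdsWithin
        (Filter.mem_of_superset (Icc_mem_nhdsGE hs.2) (Icc_subset_Icc_left hs.1))
      refine (h1.star.mul h1).congr_deriv ?_
      rw [star_neg, star_mul, UnitaryLie.star_skew]
      noncomm_ring
  -- Unitarity of `x` is known only on `[a, b]`, so the time is clamped to get a map on all of `ℝ`.
  refine ⟨fun t => ⟨x (projIcc a b hab t), Matrix.mem_unitaryGroup_iff'.2
    (hx1 _ (projIcc a b hab t).2)⟩, ?_, fun t ht => ?_⟩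
  · apply Subtype.ext
    simpa using hx0
  · have e : ∀ s ∈ Icc a b, x (projIcc a b hab s) = x s := fun s hs => by
      rw [projIcc_of_mem hab hs]
    have h := (hx t ht).congr e (e t ht)
    simp only [e t ht]
    exact h

section Transport

variable {n d k : ℕ} {X P : Type*}
  [TopologicalSpace X] [ChartedSpace (EuclideanSpace ℝ (Fin d)) X]
  [TopologicalSpace P] [ChartedSpace (EuclideanSpace ℝ (Fin k)) P] [IsManifold (𝓡 k) ∞ P]
  {B : PrincipalBundle n d k X P} (Ω : Connection B)

namespace Connection

/-- The pullback of the connection form to a `C¹` curve is continuous. -/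
theorem continuousOn_form_mfderivWithin {q : ℝ → P} {S : Set ℝ} (hS : UniqueDiffOn ℝ S)
    (hq : ContMDiffOn 𝓘(ℝ, ℝ) (𝓡 k) 1 q S) :
    ContinuousOn (fun t => Ω.form (q t) (mfderivWithin 𝓘(ℝ, ℝ) (𝓡 k) q S t (1 : ℝ))) S := by
  have h1 := hq.continuousOn_tangentMapWithin le_rfl hS.uniqueMDiffOn
  have h2 : Continuous (fun t : ℝ => (⟨t, (1 : ℝ)⟩ : TangentBundle 𝓘(ℝ, ℝ) ℝ)) :=
    (tangentBundleModelSpaceHomeomorph 𝓘(ℝ, ℝ)).symm.continuous.comp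
      (continuous_id.prodMk continuous_const)
  exact Ω.smooth.continuous.comp_continuousOn (h1.comp h2.continuousOn fun t ht => ht)

/-- `γ` is a `C¹` curve on `S` whose tangent vectors are annihilated by the connection form. -/
def IsHorizontalOn (γ : ℝ → P) (S : Set ℝ) : Prop :=
  ContMDiffOn 𝓘(ℝ, ℝ) (𝓡 k) 1 γ S ∧
    ∀ s ∈ S, Ω.form (γ s) (mfderivWithin 𝓘(ℝ, ℝ) (𝓡 k) γ S s (1 : ℝ)) = 0

variable {Ω} in
theorem IsHorizontalOn.congr {γ γ' : ℝ → P} {S : Set ℝ} (h : Ω.IsHorizontalOn γ S)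
    (e : ∀ s ∈ S, γ' s = γ s) : Ω.IsHorizontalOn γ' S := by
  refine ⟨h.1.congr e, fun s hs => ?_⟩
  rw [mfderivWithin_congr e (e s hs), e s hs]
  exact h.2 s hs

/-- The curve `c` has piecewise horizontal lifts over `[a, b]` with arbitrary starting points. -/
def HasLifts (c : ℝ → X) (a b : ℝ) : Prop :=
  ∀ p, B.proj p = c a → ∃ (γ : ℝ → P) (N : ℕ) (t : ℕ → ℝ), t 0 = a ∧ t N = b ∧
    (∀ i < N, t i < t (i + 1)) ∧ (∀ i < N, Ω.IsHorizontalOn γ (Icc (t i) (t (i + 1)))) ∧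
    (∀ s ∈ Icc a b, B.proj (γ s) = c s) ∧ γ a = p

theorem hasLifts_refl (c : ℝ → X) (a : ℝ) : Ω.HasLifts c a a := fun p hp =>
  ⟨fun _ => p, 0, fun _ => a, rfl, rfl, fun _ h => absurd h (Nat.not_lt_zero _),
    fun _ h => absurd h (Nat.not_lt_zero _), fun s hs => by
      rw [hp, le_antisymm hs.1 hs.2], rfl⟩

variable {Ω} in
theorem HasLifts.trans {c : ℝ → X} {a b e : ℝ} (hab : a ≤ b)
    (h₁ : Ω.HasLifts c a b) (h₂ : Ω.HasLifts c b e) : Ω.HasLifts c a e := by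
  intro p hp
  obtain ⟨γ₁, N₁, t₁, z₁, o₁, l₁, H₁, L₁, i₁⟩ := h₁ p hp
  obtain ⟨γ₂, N₂, t₂, z₂, o₂, l₂, H₂, L₂, i₂⟩ := h₂ (γ₁ b) (L₁ b (right_mem_Icc.2 hab))
  have hm₁ : ∀ j ≤ N₁, t₁ j ≤ b := fun j hj =>
    o₁ ▸ le_of_partition l₁ hj le_rfl
  have hm₂ : ∀ j ≤ N₂, b ≤ t₂ j := fun j hj => z₂ ▸ le_of_partition l₂ (Nat.zero_le j) hj
  have e₂ : ∀ s, b ≤ s → (if s ≤ b then γ₁ s else γ₂ s) = γ₂ s := fun s hs => by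
    split_ifs with h
    · rw [le_antisymm h hs, i₂]
    · rfl
  -- The two formulas agree at the junction index `N₁`, since `t₁ N₁ = b = t₂ 0`.
  set t : ℕ → ℝ := fun i => if i ≤ N₁ then t₁ i else t₂ (i - N₁)
  have ht₁ : ∀ i ≤ N₁, t i = t₁ i := fun i hi => if_pos hi
  have ht₂ : ∀ j, t (N₁ + j) = t₂ j := fun j => by
    rcases j.eq_zero_or_pos with rfl | hj
    · rw [add_zero, ht₁ _ le_rfl, o₁, z₂]
    · simp only [t]
      rw [if_neg (by omega), Nat.add_sub_cancel_left]
  refine ⟨fun s => if s ≤ b then γ₁ s else γ₂ s, N₁ + N₂, t, ?_, ?_, ?_, ?_, ?_, ?_⟩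
  · rw [ht₁ _ (Nat.zero_le _), z₁]
  · rw [ht₂, o₂]
  · intro i hi
    by_cases h : i < N₁
    · rw [ht₁ i h.le, ht₁ _ h]; exact l₁ i h
    · obtain ⟨j, rfl⟩ := Nat.exists_eq_add_of_le (not_lt.1 h)
      rw [add_assoc, ht₂, ht₂]; exact l₂ j (by omega)
  · intro i hi
    by_cases h : i < N₁
    · rw [ht₁ i h.le, ht₁ _ h]
      exact (H₁ i h).congr fun s hs => if_pos (hs.2.trans (hm₁ _ h))
    · obtain ⟨j, rfl⟩ := Nat.exists_eq_add_of_le (not_lt.1 h)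
      rw [add_assoc, ht₂, ht₂]
      exact (H₂ j (by omega)).congr fun s hs => e₂ s ((hm₂ j (by omega)).trans hs.1)
  · intro s hs
    by_cases h : s ≤ b
    · simp only [if_pos h]; exact L₁ s ⟨hs.1, h⟩
    · simp only [if_neg h]; exact L₂ s ⟨(not_le.1 h).le, hs.2⟩
  · simp only [if_pos hab]; exact i₁

/-- A curve of local sections can be corrected to a horizontal curve by the structure group. -/
theorem exists_isHorizontalOn_act {q : ℝ → P} {S : Set ℝ} (hS : UniqueDiffOn ℝ S)
    (hq : ContMDiffOn 𝓘(ℝ, ℝ) (𝓡 k) 1 q S) {a b K : ℝ} (hab : a < b) (hJ : Icc a b ⊆ S)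
    (hK : ∀ t ∈ Icc a b, ‖Ω.form (q t) (mfderivWithin 𝓘(ℝ, ℝ) (𝓡 k) q S t (1 : ℝ))‖ ≤ K)
    (hK' : 2 * K * (b - a) ≤ 1) (g₀ : U n) :
    ∃ g : ℝ → U n, g a = g₀ ∧ Ω.IsHorizontalOn (fun t => B.act (q t) (g t)) (Icc a b) := by
  set α : ℝ → u n := fun t => Ω.form (q t) (mfderivWithin 𝓘(ℝ, ℝ) (𝓡 k) q S t (1 : ℝ))
  have hα : ContinuousOn α (Icc a b) := (Ω.continuousOn_form_mfderivWithin hS hq).mono hJ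
  obtain ⟨g, hg0, hg⟩ := exists_unitary_solution hab.le hα hK hK' g₀
  have hU := uniqueDiffOn_Icc hab
  refine ⟨g, hg0, ?_, fun s hs => ?_⟩
  · have hgc : ContinuousOn (fun t => (g t : Matrix (Fin n) (Fin n) ℂ)) (Icc a b) :=
      fun t ht => (hg t ht).continuousWithinAt
    have h1 : ContDiffOn ℝ 1 (fun t => (g t : Matrix (Fin n) (Fin n) ℂ)) (Icc a b) := by
      rw [contDiffOn_one_iff_derivWithin hU]
      refine ⟨fun t ht => (hg t ht).differentiableWithinAt, ?_⟩
      refine (((continuous_subtype_val.comp_continuousOn hα).mul hgc).neg).congr fun t ht => ?_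
      exact (hg t ht).derivWithin (hU t ht)
    have h2 : ContMDiffOn 𝓘(ℝ, ℝ) 𝓘(ℝ, u n) 1 g (Icc a b) := fun t ht =>
      UnitaryLie.contMDiffWithinAt_iff_coe.2 (h1.contMDiffOn t ht)
    exact (B.contMDiff_act.of_le (by simp)).comp_contMDiffOn ((hq.mono hJ).prodMk h2)
  · have hqs := ((hq.mdifferentiableOn (by simp) s (hJ hs)).hasMFDerivWithinAt).mono hJ
    obtain ⟨w, hw, hΩ⟩ := Ω.exists_hasMFDerivWithinAt_act hqs (hg s hs)
      (inv_mul_deriv_mem (hU s hs) (hg s hs))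
    rw [hw.mfderivWithin (uniqueMDiffWithinAt_iff_uniqueDiffWithinAt.2 (hU s hs))]
    apply Subtype.ext
    -- Since `g' = -α g`, the two terms `g⁻¹ α g` and `g⁻¹ g'` cancel.
    rw [hΩ, mul_neg, ← mul_assoc]
    exact add_neg_cancel _

/-- Near `s` the curve stays in a trivialising open set, where the unit section lifts it. Continuity
bounds the connection form along this lift, and the bound fixes an `ε` valid for every starting
point in the fibre. -/
theorem exists_ball_hasLifts {c : ℝ → X} {a b : ℝ} (hab : a < b)
    (hc : ContMDiffOn 𝓘(ℝ, ℝ) (𝓡 d) 1 c (Icc a b)) {s : ℝ} (hs : s ∈ Icc a b) :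
    ∃ ε > 0, ∀ a' ∈ Metric.ball s ε ∩ Icc a b, ∀ b' ∈ Metric.ball s ε ∩ Icc a b, a' ≤ b' →
      Ω.HasLifts c a' b' := by
  obtain ⟨V, hV, hsV, f, hfs, hft, -, hf, hf₁, -⟩ := B.locally_trivial (c s)
  obtain ⟨W, hW, hWV⟩ := continuousOn_iff'.1 hc.continuousOn V hV
  have hsW : s ∈ W := (hWV ▸ (⟨hsV, hs⟩ : s ∈ c ⁻¹' V ∩ Icc a b) : s ∈ W ∩ Icc a b).1
  have hS : UniqueDiffOn ℝ (W ∩ Icc a b) := by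
    rw [inter_comm]; exact (uniqueDiffOn_Icc hab).inter hW
  have hmaps : ∀ t ∈ W ∩ Icc a b, c t ∈ V := fun t ht => by rw [← hWV] at ht; exact ht.1
  set q : ℝ → P := fun t => f.symm (c t, 1)
  have hq : ContMDiffOn 𝓘(ℝ, ℝ) (𝓡 k) 1 q (W ∩ Icc a b) := by
    refine (hf.of_le (by simp)).comp ((hc.mono inter_subset_right).prodMk contMDiffOn_const)
      fun t ht => ?_
    rw [mem_preimage, hft]
    exact ⟨hmaps t ht, mem_univ _⟩
  have hproj : ∀ t ∈ W ∩ Icc a b, B.proj (q t) = c t := fun t ht => by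
    have h1 : (c t, (1 : U n)) ∈ f.target := hft ▸ ⟨hmaps t ht, mem_univ _⟩
    rw [← hf₁ _ (f.map_target h1), f.right_inv h1]
  have hα := Ω.continuousOn_form_mfderivWithin hS hq
  set α : ℝ → u n :=
    fun t => Ω.form (q t) (mfderivWithin 𝓘(ℝ, ℝ) (𝓡 k) q (W ∩ Icc a b) t (1 : ℝ))
  set K := ‖α s‖ + 1
  have hK0 : 0 < K := by positivity
  obtain ⟨δ, hδ, hδK⟩ := Metric.continuousWithinAt_iff.1 (hα s ⟨hsW, hs⟩) 1 one_pos
  obtain ⟨η, hη, hηW⟩ := Metric.isOpen_iff.1 hW s hsW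
  -- Two points of the ball are at most `2 / (4 * K)` apart, which gives `2 * K * (b' - a') ≤ 1`.
  refine ⟨min (min δ η) (1 / (4 * K)), by positivity, fun a' ha b' hb hab' => ?_⟩
  rcases hab'.eq_or_lt with rfl | hab'
  · exact Ω.hasLifts_refl _ _
  have hball : Icc a' b' ⊆ Metric.ball s (min (min δ η) (1 / (4 * K))) := by
    rw [Real.ball_eq_Ioo] at ha hb ⊢
    exact fun t ht => ⟨ha.1.1.trans_le ht.1, ht.2.trans_lt hb.1.2⟩
  have hJ : Icc a' b' ⊆ W ∩ Icc a b := fun t ht =>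
    ⟨hηW (Metric.ball_subset_ball ((min_le_left _ _).trans (min_le_right _ _)) (hball ht)),
      ha.2.1.trans ht.1, ht.2.trans hb.2.2⟩
  have hK : ∀ t ∈ Icc a' b', ‖α t‖ ≤ K := fun t ht => by
    have h1 := hδK (hJ ht)
      (Metric.ball_subset_ball ((min_le_left _ _).trans (min_le_left _ _)) (hball ht))
    rw [dist_eq_norm] at h1
    have h2 := norm_sub_norm_le (α t) (α s)
    linarith
  have hK' : 2 * K * (b' - a') ≤ 1 := by
    have h1 := Metric.ball_subset_ball (min_le_right _ _) (hball (left_mem_Icc.2 hab'.le))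
    have h2 := Metric.ball_subset_ball (min_le_right _ _) (hball (right_mem_Icc.2 hab'.le))
    rw [Real.ball_eq_Ioo] at h1 h2
    have h3 : b' - a' ≤ 2 * (1 / (4 * K)) := by linarith [h1.1, h2.2]
    calc 2 * K * (b' - a') ≤ 2 * K * (2 * (1 / (4 * K))) := by gcongr
      _ = 1 := by field_simp; norm_num
  intro p hp
  obtain ⟨g₀, hg₀⟩ := B.exists_act_eq (p := q a') (q := p)
    (hp.trans (hproj a' (hJ (left_mem_Icc.2 hab'.le))).symm)
  obtain ⟨g, hg, hH⟩ := Ω.exists_isHorizontalOn_act hS hq hab' hJ hK hK' g₀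
  refine ⟨fun t => B.act (q t) (g t), 1, fun i => if i = 0 then a' else b', rfl, rfl, ?_, ?_, fun t ht => ?_,
    (congrArg (B.act (q a')) hg).trans hg₀.symm⟩
  · intro i hi
    obtain rfl : i = 0 := by omega
    simpa using hab'
  · intro i hi
    obtain rfl : i = 0 := by omega
    simpa using hH
  · rw [B.proj_act, hproj t (hJ ht)]

/-- By compactness a finite subdivision has each step inside one of the balls of
`exists_ball_hasLifts`. The subdivision may repeat points, which is why lifts over a degenerate
interval are allowed. -/
theorem hasLifts_of_contMDiffOn {c : ℝ → X} {a b : ℝ} (hab : a < b)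
    (hc : ContMDiffOn 𝓘(ℝ, ℝ) (𝓡 d) 1 c (Icc a b)) : Ω.HasLifts c a b := by
  choose ε hε hL using fun s : Icc a b => Ω.exists_ball_hasLifts hab hc s.2
  obtain ⟨t, h0, hmono, ⟨m, hm⟩, hsub⟩ := exists_monotone_Icc_subset_open_cover_Icc hab.le
    (c := fun s : Icc a b => Metric.ball s (ε s)) (fun s => Metric.isOpen_ball)
    (fun s _ => mem_iUnion.2 ⟨s, Metric.mem_ball_self (hε s)⟩)
  have key : ∀ j, Ω.HasLifts c a (t j) := fun j => by
    induction j with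
    | zero => rw [h0]; exact Ω.hasLifts_refl _ _
    | succ j ih =>
      obtain ⟨s, hs⟩ := hsub j
      have hj := hmono (Nat.le_succ j)
      refine ih.trans (t j).2.1 (hL s _ ⟨?_, (t j).2⟩ _ ⟨?_, (t (j + 1)).2⟩ hj)
      · exact hs (left_mem_Icc.2 hj)
      · exact hs (right_mem_Icc.2 hj)
  exact hm m le_rfl ▸ key m

/-- Existence of horizontal lifts. -/
theorem exists_isHorizontalLift {c : unitInterval → X} (hc : IsPiecewiseC1 d c)
    (p : B.fiber (c 0)) : ∃ γ, Ω.IsHorizontalLift c γ ∧ γ 0 = p := by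
  obtain ⟨N, t, ht⟩ := hc
  have key : ∀ j ≤ N, Ω.HasLifts (extend c) 0 (t j) := fun j hj => by
    induction j with
    | zero => rw [ht.zero]; exact Ω.hasLifts_refl _ _
    | succ j ih =>
      exact (ih (by omega)).trans (ht.zero ▸ le_of_partition ht.lt (Nat.zero_le j) (by omega))
        (Ω.hasLifts_of_contMDiffOn (ht.lt j hj) (ht.contMDiffOn j hj))
  obtain ⟨γ, M, r, z, o, l, H, L, i⟩ := (ht.one ▸ key N le_rfl) p
    (p.2.trans (extend_coe c 0).symm)
  -- `γ` is arbitrary outside `[0, 1]`; only its restriction is kept.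
  have hext : ∀ s ∈ Icc (0 : ℝ) 1, extend (fun s : unitInterval => γ s) s = γ s := fun s hs =>
    extend_of_mem _ hs
  have H' : ∀ j < M, Ω.IsHorizontalOn (extend (fun s : unitInterval => γ s))
      (Icc (r j) (r (j + 1))) := fun j hj => (H j hj).congr fun s hs =>
    hext s ⟨(z ▸ le_of_partition l (Nat.zero_le j) hj.le).trans hs.1,
      hs.2.trans (o ▸ le_of_partition l hj le_rfl)⟩
  refine ⟨fun s => γ s, ⟨⟨M, r, ⟨z, o, l, fun j hj => (H' j hj).1⟩, fun j hj => (H' j hj).2⟩,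
    fun s => ?_⟩, i⟩
  rw [L s s.2, extend_coe]

end Connection

end Transport

/-! ### Parallel transport, holonomy and equivariant connections -/

section Transport

variable {n d k : ℕ} {X P : Type*}
  [TopologicalSpace X] [ChartedSpace (EuclideanSpace ℝ (Fin d)) X]
  [TopologicalSpace P] [ChartedSpace (EuclideanSpace ℝ (Fin k)) P] [IsManifold (𝓡 k) ∞ P]
  {B : PrincipalBundle n d k X P} {Ω : Connection B}

namespace Connection

/-- Existence and uniqueness of horizontal lifts. -/
theorem existsUnique_isHorizontalLift (Ω : Connection B) {c : unitInterval → X}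
    (hc : IsPiecewiseC1 d c) (p : B.fiber (c 0)) : ∃! γ, Ω.IsHorizontalLift c γ ∧ γ 0 = p := by
  obtain ⟨γ, hγ, h0⟩ := Ω.exists_isHorizontalLift hc p
  exact ⟨γ, ⟨hγ, h0⟩, fun γ' h => h.1.eq hγ (h.2.trans h0.symm)⟩

/-- By uniqueness, the lift chosen in the definition of `PT` is any given one. -/
theorem IsHorizontalLift.coe_PT {c : unitInterval → X} {γ : unitInterval → P}
    (hγ : Ω.IsHorizontalLift c γ) {p : B.fiber (c 0)} (h0 : γ 0 = p) : (Ω.PT c p : P) = γ 1 := by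
  have h : ∃ γ, Ω.IsHorizontalLift c γ ∧ γ 0 = p := ⟨γ, hγ, h0⟩
  rw [PT, dif_pos h]
  exact congrFun (h.choose_spec.1.eq hγ (h.choose_spec.2.trans h0.symm)) 1

/-- A map of the total space that covers a map of the base and preserves horizontal vectors maps
horizontal lifts to horizontal lifts. -/
theorem IsHorizontalLift.comp {c : unitInterval → X} {γ : unitInterval → P}
    (hγ : Ω.IsHorizontalLift c γ) {τ : X → X} {Θ : P → P} (hΘ : IsInvolutiveLift B τ Θ)
    (hker : ∀ (p : P) (v : TangentSpace (𝓡 k) p), Ω.form p v = 0 →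
      Ω.form (Θ p) (mfderiv (𝓡 k) (𝓡 k) Θ p v) = 0) :
    Ω.IsHorizontalLift (τ ∘ c) (Θ ∘ γ) := by
  obtain ⟨⟨N, t, ht, h0⟩, hp⟩ := hγ
  refine ⟨⟨N, t, ⟨ht.zero, ht.one, ht.lt, fun i hi => ?_⟩, fun i hi s hs => ?_⟩, fun s => ?_⟩
  · exact (hΘ.smooth.of_le (by simp)).comp_contMDiffOn (ht.contMDiffOn i hi)
  · have h1 := ((ht.contMDiffOn i hi).mdifferentiableOn (by simp) s hs).hasMFDerivWithinAt
    have h2 := ((hΘ.smooth.mdifferentiable (by simp)) (extend γ s)).hasMFDerivAt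
    have h3 := h2.comp_hasMFDerivWithinAt s h1
    have hU := uniqueMDiffWithinAt_iff_uniqueDiffWithinAt.2 (uniqueDiffOn_Icc (ht.lt i hi) s hs)
    rw [extend_comp, h3.mfderivWithin hU]
    exact hker _ _ (h0 i hi s hs)
  · exact (hΘ.proj_apply _).trans (congrArg τ (hp s))

/-- Parallel transport commutes with a bundle map that preserves horizontal vectors. -/
theorem PT_comp_onFiber (Ω : Connection B) {c : unitInterval → X} (hc : IsPiecewiseC1 d c)
    {τ : X → X} {Θ : P → P} (hΘ : IsInvolutiveLift B τ Θ)
    (hker : ∀ (p : P) (v : TangentSpace (𝓡 k) p), Ω.form p v = 0 →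
      Ω.form (Θ p) (mfderiv (𝓡 k) (𝓡 k) Θ p v) = 0) :
    Ω.PT (τ ∘ c) ∘ hΘ.onFiber (c 0) = hΘ.onFiber (c 1) ∘ Ω.PT c := by
  funext p
  obtain ⟨γ, hγ, h0⟩ := Ω.exists_isHorizontalLift hc p
  apply Subtype.ext
  calc (Ω.PT (τ ∘ c) (hΘ.onFiber (c 0) p) : P) = Θ (γ 1) :=
        (hγ.comp hΘ hker).coe_PT (congrArg Θ h0)
    _ = Θ (Ω.PT c p) := by rw [hγ.coe_PT h0]

theorem act_hol (Ω : Connection B) (c : unitInterval → X) (hc : c 0 = c 1)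
    (p : B.fiber (c 0)) : B.act p (Ω.hol c hc p) = Ω.PT c p :=
  (Ω.exists_PT_eq hc p).choose_spec.symm

/-- The holonomy of the image of a loop under a bundle map that preserves horizontal vectors. -/
theorem hol_comp_onFiber (Ω : Connection B) {c : unitInterval → X} (hc : IsPiecewiseC1 d c)
    {τ : X → X} {Θ : P → P} (hΘ : IsInvolutiveLift B τ Θ)
    (hker : ∀ (p : P) (v : TangentSpace (𝓡 k) p), Ω.form p v = 0 →
      Ω.form (Θ p) (mfderiv (𝓡 k) (𝓡 k) Θ p v) = 0)
    {φ : U n → U n} (hφ : ∀ p g, Θ (B.act p g) = B.act (Θ p) (φ g))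
    (hl : c 0 = c 1) (p : B.fiber (c 0)) :
    Ω.hol (τ ∘ c) (congrArg τ hl) (hΘ.onFiber (c 0) p) = φ (Ω.hol c hl p) := by
  -- The action is free, so it suffices to compare the two translates of `Θ p`.
  apply B.act_left_cancel (p := Θ p)
  have h := congrArg Subtype.val (congrFun (Ω.PT_comp_onFiber hc hΘ hker) p)
  calc B.act (Θ p) (Ω.hol (τ ∘ c) (congrArg τ hl) (hΘ.onFiber (c 0) p))
      = Ω.PT (τ ∘ c) (hΘ.onFiber (c 0) p) := Ω.act_hol (τ ∘ c) (congrArg τ hl) (hΘ.onFiber (c 0) p)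
    _ = Θ (Ω.PT c p) := h
    _ = B.act (Θ p) (φ (Ω.hol c hl p)) := by rw [← Ω.act_hol c hl p, hφ]

end Connection

theorem conjM_conjM (a : Matrix (Fin n) (Fin n) ℂ) : conjM (conjM a) = a := by
  ext i j; simp [conjM]

theorem conjM_eq_zero {a : Matrix (Fin n) (Fin n) ℂ} : conjM a = 0 ↔ a = 0 := by
  refine ⟨fun h => ?_, fun h => ?_⟩
  · rw [← conjM_conjM a, h]
    ext; simp [conjM]
  · rw [h]
    ext; simp [conjM]

/-- `Q` is invertible because `Q * Q = -1`, so it can be stripped from both sides. -/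
theorem sigmaM_eq_zero {m : ℕ} {a : Matrix (Fin (2 * m)) (Fin (2 * m)) ℂ} (h : sigmaM a = 0) :
    a = 0 := by
  rw [sigmaM, neg_eq_zero] at h
  rw [← conjM_eq_zero]
  calc conjM a = (Q m * Q m) * conjM a * (Q m * Q m) := by simp [Q_mul_Q]
    _ = Q m * (Q m * conjM a * Q m) * Q m := by simp only [mul_assoc]
    _ = 0 := by rw [h, mul_zero, zero_mul]

theorem IsRealConnection.form_mfderiv_eq_zero {Θ : P → P} (h : IsRealConnection Ω Θ) (p : P)
    (v : TangentSpace (𝓡 k) p) (hv : Ω.form p v = 0) :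
    Ω.form (Θ p) (mfderiv (𝓡 k) (𝓡 k) Θ p v) = 0 :=
  Subtype.ext (conjM_eq_zero.1 ((h p v).trans (congrArg Subtype.val hv)))

theorem IsQuaternionicConnection.form_mfderiv_eq_zero {m : ℕ}
    {B : PrincipalBundle (2 * m) d k X P} {Ω : Connection B} {Θ : P → P}
    (h : IsQuaternionicConnection Ω Θ) (p : P) (v : TangentSpace (𝓡 k) p) (hv : Ω.form p v = 0) :
    Ω.form (Θ p) (mfderiv (𝓡 k) (𝓡 k) Θ p v) = 0 :=
  Subtype.ext (sigmaM_eq_zero ((h p v).trans (congrArg Subtype.val hv)))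

end Transport

end TimeReversal

open TimeReversal in
/-- Parallel transport and holonomy of equivariant connections. -/
theorem proposition2p5 {d k : ℕ} {X P : Type*}
    [TopologicalSpace X] [ChartedSpace (EuclideanSpace ℝ (Fin d)) X] [IsManifold (𝓡 d) ∞ X]
    [CompactSpace X] [T2Space X] [PathConnectedSpace X]
    (τ : X → X) (hτ : ContMDiff (𝓡 d) (𝓡 d) ∞ τ) (hτ' : Function.Involutive τ)
    [TopologicalSpace P] [ChartedSpace (EuclideanSpace ℝ (Fin k)) P] [IsManifold (𝓡 k) ∞ P] :
    (∀ (m : ℕ) (B : PrincipalBundle m d k X P) (Θ : P → P) (hΘ : IsRealStructure B τ Θ)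
        (Ω : Connection B), IsRealConnection Ω Θ →
      ∀ c : unitInterval → X, IsPiecewiseC1 d c →
        (∀ p : B.fiber (c 0), ∃! γ : unitInterval → P, Ω.IsHorizontalLift c γ ∧ γ 0 = p) ∧
        Ω.PT (τ ∘ c) ∘ hΘ.onFiber (c 0) = hΘ.onFiber (c 1) ∘ Ω.PT c ∧
        ∀ (hc : c 0 = c 1) (p : B.fiber (c 0)),
          (Ω.hol (τ ∘ c) (congrArg τ hc) (hΘ.onFiber (c 0) p) : Matrix (Fin m) (Fin m) ℂ) =
            conjM (Ω.hol c hc p : Matrix (Fin m) (Fin m) ℂ)) ∧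
    (∀ (m : ℕ) (B : PrincipalBundle (2 * m) d k X P) (Θ : P → P)
        (hΘ : IsQuaternionicStructure B τ Θ)
        (Ω : Connection B), IsQuaternionicConnection Ω Θ →
      ∀ c : unitInterval → X, IsPiecewiseC1 d c →
        (∀ p : B.fiber (c 0), ∃! γ : unitInterval → P, Ω.IsHorizontalLift c γ ∧ γ 0 = p) ∧
        Ω.PT (τ ∘ c) ∘ hΘ.onFiber (c 0) = hΘ.onFiber (c 1) ∘ Ω.PT c ∧
        ∀ (hc : c 0 = c 1) (p : B.fiber (c 0)),
          (Ω.hol (τ ∘ c) (congrArg τ hc) (hΘ.onFiber (c 0) p) :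
              Matrix (Fin (2 * m)) (Fin (2 * m)) ℂ) =
            -(Q m * conjM (Ω.hol c hc p : Matrix (Fin (2 * m)) (Fin (2 * m)) ℂ) * Q m)) := by
  refine ⟨fun m B Θ hΘ Ω hΩ c hc => ⟨Ω.existsUnique_isHorizontalLift hc,
    Ω.PT_comp_onFiber hc hΘ.toIsInvolutiveLift hΩ.form_mfderiv_eq_zero, fun hl p => ?_⟩,
    fun m B Θ hΘ Ω hΩ c hc => ⟨Ω.existsUnique_isHorizontalLift hc,
    Ω.PT_comp_onFiber hc hΘ.toIsInvolutiveLift hΩ.form_mfderiv_eq_zero, fun hl p => ?_⟩⟩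
  · exact congrArg Subtype.val (Ω.hol_comp_onFiber hc hΘ.toIsInvolutiveLift
      hΩ.form_mfderiv_eq_zero hΘ.apply_act hl p)
  · exact congrArg Subtype.val (Ω.hol_comp_onFiber hc hΘ.toIsInvolutiveLift
      hΩ.form_mfderiv_eq_zero hΘ.apply_act hl p)
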